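/- Let $T$ be a $\sigma$-compact topological monoid (a topological semigroup with identity $e$) acting jointly continuously on a compact Hausdorff space $X$ with at least two points, with $ex=x$ and $(st)x=s(tx)$. Let $\mathscr U_X$ be the unique compatible uniformity of $X$. Assume that - $(T,X)$ is minimal: $Tx$ is dense in $X$ for every $x\in X$; - $(T,X)$ has an invariant measure: there is a Borel probability measure $\mu$ on $X$ with $\mu(t^{-1}B)=\mu(B)$ for all Borel $B\subseteq X$ and all $t\in T$, where $t^{-1}B=\{x: tx\in B\}$; - $(T,X)$ is weak-mixing: for all non-empty open $U,V\subseteq X\times X$ there are $t\in T$ and $(x,y)\in U$ with $(tx,ty)\in V$. For $\varepsilon\in\mathscr U_X$ and $x\in X$ let $W^s_\varepsilon(x)$ be the set of all $y\in X$ for which there is a non-empty compact $K\subseteq T$ with $(tx,ty)\in\varepsilon$ for all $t\in T\setminus K$. Then there is a symmetric entourage $\varepsilon\in\mathscr U_X$ such that: 1. for every entourage $\delta\in\mathscr U_X$ with $\delta\subseteq\varepsilon$, $(T,X)$ is $\varepsilon$-$\delta$ Li–Yorke sensitive, that is, for every $x\in X$ the set $\{y\in X: y\notin W^s_\varepsilon(x)\text{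 and }(tx,ty)\in\delta\text{ for some }t\in T\}$ is of the second category (non-meagre) in $X$; 2. if moreover $X$ is metrizable, then $(T,X)$ is $\varepsilon$-$0$ Li–Yorke sensitive, that is, for every $x\in X$ the set of all $y\in X\setminus W^s_\varepsilon(x)$ for which there are a sequence $(t_n)$ in $T$ and a point $z\in X$ with $(t_nx,t_ny)\to(z,z)$ is of the second category (non-meagre) in $X$. -/

import Mathlib

open Set Filter Topology Uniformity MeasureTheory

namespace Semiflow

/-- The semiflow `(T, X)` is weak-mixing: the diagonal action of `T` on `X × X` is topologically
transitive, i.e. for all non-empty open `U, V ⊆ X × X` there is `t` with `tU ∩ V ≠ ∅`. -/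
def WeakMixing (T X : Type*) [Monoid T] [TopologicalSpace X] [MulAction T X] : Prop :=
  MulAction.IsTopologicallyTransitive T (X × X)

/-- `(T, X)` admits an invariant Borel probability measure: `μ (t⁻¹ B) = μ B` for all Borel `B`
and all `t` in `T`. -/
def AdmitsInvariantMeasure (T X : Type*) [Monoid T] [MulAction T X] [MeasurableSpace X] : Prop :=
  ∃ μ : Measure X, IsProbabilityMeasure μ ∧ SMulInvariantMeasure T X μ

/-- The `ε`-stable set of `x`: all `y` such that `(tx, ty) ∈ ε` for all `t` outside some non-empty
compact subset of `T`. -/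
def stableSet (T : Type*) {X : Type*} [Monoid T] [TopologicalSpace T] [MulAction T X]
    (ε : Set (X × X)) (x : X) : Set X :=
  {y | ∃ K : Set T, K.Nonempty ∧ IsCompact K ∧ ∀ t, t ∉ K → (t • x, t • y) ∈ ε}

/-- The set `LY_{ε-δ}[x]`. -/
def liYorkeSet (T : Type*) {X : Type*} [Monoid T] [TopologicalSpace T] [MulAction T X]
    (ε δ : Set (X × X)) (x : X) : Set X :=
  {y | y ∉ stableSet T ε x ∧ ∃ t : T, (t • x, t • y) ∈ δ}

/-- The set `LY_{ε-0}[x]` of those `y` outside the `ε`-stable set of `x` for which there is a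
sequence `tₙ` in `T` such that `(tₙ x, tₙ y)` converges to a point of the diagonal. -/
def liYorkeSetZero (T : Type*) {X : Type*} [Monoid T] [TopologicalSpace T] [TopologicalSpace X]
    [MulAction T X] (ε : Set (X × X)) (x : X) : Set X :=
  {y | y ∉ stableSet T ε x ∧
    ∃ (t : ℕ → T) (z : X), Tendsto (fun n => (t n • x, t n • y)) atTop (𝓝 (z, z))}

/-- `ε`-`δ` Li–Yorke sensitivity: every `LY_{ε-δ}[x]` is of the second category (non-meagre). -/
def LiYorkeSensitive (T X : Type*) [Monoid T] [TopologicalSpace T] [TopologicalSpace X]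
    [MulAction T X] (ε δ : Set (X × X)) : Prop :=
  ∀ x : X, ¬ IsMeagre (liYorkeSet T ε δ x)

/-- `ε`-`0` Li–Yorke sensitivity: every `LY_{ε-0}[x]` is of the second category (non-meagre). -/
def LiYorkeSensitiveZero (T X : Type*) [Monoid T] [TopologicalSpace T] [TopologicalSpace X]
    [MulAction T X] (ε : Set (X × X)) : Prop :=
  ∀ x : X, ¬ IsMeagre (liYorkeSetZero T ε x)

end Semiflow

/-! Everything rests on `eq_univ_of_isClosed_of_invariant`. If `M ⊆ X × X` is closed and forward
invariant, the measure of its sections is upper semicontinuous and does not decrease along orbits,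
so minimality makes it constant. Weak mixing does the same for intersections of two sections, so all
sections agree up to null sets. By full support, an open set inside one section lies in all of them,
and transitivity gives `M = univ`.

Hence, for fixed `x`, the pairs `(tx, ty)` with `y` in any given nonempty open set are dense. Thus
approaching the diagonal is residual in `y`, while staying `ε`-close off a compact set of times is
nowhere dense once `ε ○ ε` lies in a proper closed set. Baire's theorem combines the two. -/

namespace Semiflow

/-! ### Invariant measures: regularity and full support -/

section Measure

variable {T X : Type*} [Monoid T] [TopologicalSpace X] [CompactSpace X]
  [MeasurableSpace X] [BorelSpace X] [MulAction T X]

/-- An invariant Borel probability measure can be replaced by a regular finite one. -/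
theorem AdmitsInvariantMeasure.exists_regular [T2Space X] [ContinuousConstSMul T X]
    (h : AdmitsInvariantMeasure T X) :
    ∃ ν : Measure X, ν.Regular ∧ IsFiniteMeasure ν ∧ ν ≠ 0 ∧
      ∀ (t : T) (s : Set X), MeasurableSet s → ν ((t • ·) ⁻¹' s) = ν s := by
  obtain ⟨μ, _, hμ⟩ := h
  obtain ⟨ν, _, _, hν⟩ := μ.exists_regular_eq_of_compactSpace
  refine ⟨ν, ‹_›, ‹_›, ?_, fun t s hs => ?_⟩
  · rintro rfl
    have := hν (BoundedContinuousFunction.const X 1)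
    simp at this
  · have hc : Continuous fun x : X => t • x := continuous_const_smul t
    have : (ν.map (t • ·)).InnerRegularCompactLTTop :=
      Measure.InnerRegularCompactLTTop.map_of_continuous hc
    have : IsFiniteMeasure (ν.map (t • ·)) := Measure.isFiniteMeasure_map ν _
    -- Both sides are regular, so equal integrals of continuous functions suffice; these transfer
    -- from `μ`.
    have key : ν.map (t • ·) = ν := by
      apply Measure.ext_of_integral_eq_on_compactlySupported
      intro f
      have hf : Continuous f := f.continuous
      rw [integral_map hc.aemeasurable hf.aestronglyMeasurable]
      have h1 := hν (BoundedContinuousFunction.mkOfCompact ⟨fun x => f (t • x), hf.comp hc⟩)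
      have h2 := hν (BoundedContinuousFunction.mkOfCompact ⟨f, hf⟩)
      simp only [BoundedContinuousFunction.mkOfCompact_apply, ContinuousMap.coe_mk] at h1 h2
      rw [← h1, ← h2]
      conv_rhs => rw [← (measurePreserving_smul t μ).map_eq]
      rw [integral_map hc.aemeasurable hf.aestronglyMeasurable]
    conv_rhs => rw [← key, Measure.map_apply hc.measurable hs]

/-- In a minimal semiflow, a nonzero invariant measure has full support. -/
theorem measure_pos_of_isOpen [ContinuousConstSMul T X] (hmin : MulAction.IsMinimal T X)
    {ν : Measure X} (hν0 : ν ≠ 0)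
    (hinv : ∀ (t : T) (s : Set X), MeasurableSet s → ν ((t • ·) ⁻¹' s) = ν s)
    {V : Set X} (hV : IsOpen V) (hVne : V.Nonempty) : ν V ≠ 0 := by
  intro h0
  -- By minimality and compactness, finitely many preimages of `V`, all as null as `V`, cover `X`.
  obtain ⟨F, hF⟩ := isCompact_univ.elim_finite_subcover (fun t : T => (t • ·) ⁻¹' V)
    (fun t => hV.preimage (continuous_const_smul t)) (hV.iUnion_preimage_smul T hVne).ge
  apply hν0
  rw [← Measure.measure_univ_eq_zero]
  refine measure_mono_null hF ((measure_biUnion_null_iff F.countable_toSet).2 fun t _ => ?_)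
  rw [hinv t V hV.measurableSet, h0]

/-- Every translation is surjective when the semiflow is minimal with an invariant measure. -/
theorem surjective_smul_of_invariant [T2Space X] [ContinuousConstSMul T X] (hmin : MulAction.IsMinimal T X)
    (h : AdmitsInvariantMeasure T X) (t : T) : Function.Surjective fun x : X => t • x := by
  obtain ⟨ν, _, _, hν0, hinv⟩ := h.exists_regular
  have hcl : IsClosed (range fun x : X => t • x) :=
    (isCompact_range (continuous_const_smul t)).isClosed
  by_contra hs
  refine measure_pos_of_isOpen hmin hν0 hinv hcl.isOpen_compl
    (nonempty_compl.2 fun h => hs (range_eq_univ.1 h)) ?_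
  rw [← hinv t _ hcl.isOpen_compl.measurableSet]
  convert measure_empty (μ := ν)
  ext x
  simp

end Measure

/-! ### Semicontinuity of sections of closed sets -/

section Sections

variable {Z X : Type*} [TopologicalSpace Z] [TopologicalSpace X] [CompactSpace X]

/-- The sections of a closed set depend upper semicontinuously on the base point. -/
theorem eventually_section_subset {N : Set (Z × X)} (hN : IsClosed N) {z : Z} {O : Set X}
    (hO : IsOpen O) (h : Prod.mk z ⁻¹' N ⊆ O) : ∀ᶠ z' in 𝓝 z, Prod.mk z' ⁻¹' N ⊆ O := by
  have := hO.isClosed_compl.isCompact.eventually_forall_of_forall_eventually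
    (x₀ := z) (P := fun z' x => (z', x) ∉ N) fun x hx =>
      hN.isOpen_compl.mem_nhds fun hN' => hx (h hN')
  filter_upwards [this] with z' hz' x hx
  by_contra hxO
  exact hz' x hxO hx

/-- Outer regularity encloses the section in an open set of measure below `r`, which also contains
all nearby sections. -/
theorem isOpen_setOf_measure_section_lt [MeasurableSpace X] {ν : Measure X} [ν.OuterRegular]
    {N : Set (Z × X)} (hN : IsClosed N) (r : ENNReal) :
    IsOpen {z | ν (Prod.mk z ⁻¹' N) < r} := by
  refine isOpen_iff_mem_nhds.2 fun z hz => ?_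
  obtain ⟨O, hsub, hO, hlt⟩ := Set.exists_isOpen_lt_of_lt _ r hz
  filter_upwards [eventually_section_subset hN hO hsub] with z' hz'
  exact (measure_mono hz').trans_lt hlt

end Sections

/-! ### Density of pair orbits -/

section Density

variable {T X : Type*} [Monoid T] [TopologicalSpace X] [CompactSpace X] [T2Space X]
  [MeasurableSpace X] [BorelSpace X] [MulAction T X] [ContinuousConstSMul T X]

open scoped Pointwise in
/-- A closed forward invariant subset of `X × X` one of whose sections has nonempty interior is
everything. -/
theorem eq_univ_of_isClosed_of_invariant (hmin : MulAction.IsMinimal T X)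
    (hinv : AdmitsInvariantMeasure T X) (hwm : WeakMixing T X) {M : Set (X × X)}
    (hM : IsClosed M) (hMT : ∀ (t : T) (p : X × X), p ∈ M → t • p ∈ M) {x : X} {V : Set X}
    (hV : IsOpen V) (hVne : V.Nonempty) (hVM : V ⊆ Prod.mk x ⁻¹' M) : M = univ := by
  have : MulAction.IsTopologicallyTransitive T (X × X) := hwm
  obtain ⟨ν, _, _, hν0, hν⟩ := hinv.exists_regular
  have hsec : ∀ z, IsClosed (Prod.mk z ⁻¹' M) := fun z => hM.preimage (by fun_prop)
  have hle : ∀ (t : T) (z : X), ν (Prod.mk z ⁻¹' M) ≤ ν (Prod.mk (t • z) ⁻¹' M) := fun t z => by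
    rw [← hν t (Prod.mk (t • z) ⁻¹' M) (hsec _).measurableSet]
    exact measure_mono fun w hw => hMT t _ hw
  have hconst_le : ∀ z z', ν (Prod.mk z ⁻¹' M) ≤ ν (Prod.mk z' ⁻¹' M) := fun z z' => by
    refine le_of_forall_gt fun r hr => ?_
    obtain ⟨t, ht⟩ := (isOpen_setOf_measure_section_lt hM r).exists_smul_mem T z ⟨z', hr⟩
    exact (hle t z).trans_lt ht
  set c := ν (Prod.mk x ⁻¹' M) with hc
  have hconst : ∀ z, ν (Prod.mk z ⁻¹' M) = c := fun z => (hconst_le _ _).antisymm (hconst_le _ _)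
  have hctop : c ≠ ⊤ := measure_ne_top _ _
  -- the set of `((z, z'), w)` with `w` in the sections over both `z` and `z'`
  let N : Set ((X × X) × X) := {q | (q.1.1, q.2) ∈ M ∧ (q.1.2, q.2) ∈ M}
  have hN : IsClosed N :=
    (hM.preimage (by fun_prop : Continuous fun q : (X × X) × X => (q.1.1, q.2))).inter
      (hM.preimage (by fun_prop : Continuous fun q : (X × X) × X => (q.1.2, q.2)))
  have hNsec : ∀ z z', Prod.mk (z, z') ⁻¹' N = Prod.mk z ⁻¹' M ∩ Prod.mk z' ⁻¹' M :=
    fun z z' => rfl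
  have hinter : ∀ z z', c ≤ ν (Prod.mk (z, z') ⁻¹' N) := by
    intro z z'
    by_contra! hlt
    obtain ⟨r, hr, hrc⟩ := exists_between hlt
    have hU : IsOpen {p | ν (Prod.mk p ⁻¹' N) < r} := isOpen_setOf_measure_section_lt hN r
    have hdense : Dense {p | ν (Prod.mk p ⁻¹' N) < r} := by
      refine hU.dense_of_preimage_smul_invariant T ⟨(z, z'), hr⟩ fun t p hp => ?_
      refine lt_of_le_of_lt ?_ (show ν (Prod.mk (t • p) ⁻¹' N) < r from hp)
      rw [← hν t (Prod.mk (t • p) ⁻¹' N) (hN.preimage (by fun_prop)).measurableSet]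
      exact measure_mono fun w hw => ⟨hMT t _ hw.1, hMT t _ hw.2⟩
    -- The slack `c - r` is chosen so that, near `(x, x)`, two sections of measure `c` have union
    -- below `c + (c - r)` and intersection below `r`, totalling less than `2c`.
    have hpos : c < c + (c - r) :=
      ENNReal.lt_add_right hctop (tsub_pos_of_lt hrc).ne'
    obtain ⟨O, hsub, hO, hOlt⟩ := Set.exists_isOpen_lt_of_lt (Prod.mk x ⁻¹' M) _ hpos
    have hev := eventually_section_subset hM hO hsub
    have hev2 : ∀ᶠ p : X × X in 𝓝 (x, x), Prod.mk p.1 ⁻¹' M ⊆ O ∧ Prod.mk p.2 ⁻¹' M ⊆ O :=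
      hev.prod_nhds hev
    obtain ⟨⟨a, b⟩, ⟨ha, hb⟩, hab⟩ := mem_closure_iff_nhds.1 (hdense (x, x)) _ hev2
    have hab' : ν (Prod.mk a ⁻¹' M ∩ Prod.mk b ⁻¹' M) < r := hab
    have h2 := measure_union_add_inter (μ := ν) (Prod.mk a ⁻¹' M) (hsec b).measurableSet
    rw [hconst, hconst] at h2
    have h3 : c + c < c + (c - r) + r := by
      rw [← h2]
      exact ENNReal.add_lt_add ((measure_mono (union_subset ha hb)).trans_lt hOlt) hab'
    rw [add_assoc, tsub_add_cancel_of_le hrc.le] at h3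
    exact lt_irrefl _ h3
  have hVz : ∀ z, V ⊆ Prod.mk z ⁻¹' M := by
    intro z
    by_contra hnot
    have hne : (V \ Prod.mk z ⁻¹' M).Nonempty := sdiff_nonempty.2 hnot
    refine measure_pos_of_isOpen hmin hν0 hν (hV.sdiff (hsec z)) hne ?_
    have hz : ν (Prod.mk x ⁻¹' M \ Prod.mk z ⁻¹' M) = 0 := by
      have h1 := measure_inter_add_sdiff (μ := ν) (Prod.mk x ⁻¹' M) (hsec z).measurableSet
      have h2 := hinter x z
      rw [hNsec] at h2
      rw [← hc] at h1
      by_contra hpos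
      have h3 : ν (Prod.mk x ⁻¹' M ∩ Prod.mk z ⁻¹' M) <
          ν (Prod.mk x ⁻¹' M ∩ Prod.mk z ⁻¹' M) + ν (Prod.mk x ⁻¹' M \ Prod.mk z ⁻¹' M) :=
        ENNReal.lt_add_right (measure_ne_top _ _) hpos
      rw [h1] at h3
      exact absurd h2 (not_le.2 h3)
    exact measure_mono_null (sdiff_subset_sdiff_left hVM) hz
  have hUd : Dense (⋃ t : T, t • (univ ×ˢ V : Set (X × X))) :=
    (isOpen_univ.prod hV).dense_iUnion_smul T (Set.Nonempty.prod ⟨x, mem_univ x⟩ hVne)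
  rw [← hM.closure_eq, ← dense_iff_closure_eq]
  refine hUd.mono (iUnion_subset fun t => ?_)
  rintro _ ⟨⟨z, w⟩, ⟨-, hw⟩, rfl⟩
  exact hMT t _ (hVz z hw)

/-- In a minimal weak-mixing semiflow with invariant measure, the points `(tx, ty)` with `t ∈ T` and
`y` in a given nonempty open set are dense in `X × X`. -/
theorem exists_smul_mem_of_isOpen (hmin : MulAction.IsMinimal T X)
    (hinv : AdmitsInvariantMeasure T X) (hwm : WeakMixing T X) (x : X) {V : Set X}
    (hV : IsOpen V) (hVne : V.Nonempty) {O : Set (X × X)} (hO : IsOpen O) (hOne : O.Nonempty) :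
    ∃ y ∈ V, ∃ t : T, (t • x, t • y) ∈ O := by
  let S : Set (X × X) := {p | ∃ t : T, ∃ y ∈ V, p = (t • x, t • y)}
  have hS : closure S = univ := by
    refine eq_univ_of_isClosed_of_invariant hmin hinv hwm isClosed_closure (x := x)
      (fun t p hp => ?_) hV hVne fun y hy => subset_closure ⟨1, y, hy, by simp⟩
    refine map_mem_closure (continuous_const_smul t) hp ?_
    rintro _ ⟨s, y, hy, rfl⟩
    exact ⟨t * s, y, hy, by simp [mul_smul]⟩
  obtain ⟨_, hp, t, y, hy, rfl⟩ := (dense_iff_closure_eq.2 hS).inter_open_nonempty O hO hOne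
  exact ⟨y, hy, t, hp⟩

theorem isOpen_setOf_exists_smul_mem (T : Type*) {X : Type*} [Monoid T] [TopologicalSpace X]
    [MulAction T X] [ContinuousConstSMul T X] (x : X) {O : Set (X × X)} (hO : IsOpen O) :
    IsOpen {y | ∃ t : T, (t • x, t • y) ∈ O} := by
  simp only [ofPred_exists]
  exact isOpen_iUnion fun t =>
    hO.preimage (continuous_const.prodMk (continuous_const_smul t))

theorem setOf_exists_smul_mem_mem_residual (hmin : MulAction.IsMinimal T X)
    (hinv : AdmitsInvariantMeasure T X) (hwm : WeakMixing T X) (x : X) {O : Set (X × X)}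
    (hO : IsOpen O) (hOne : O.Nonempty) : {y | ∃ t : T, (t • x, t • y) ∈ O} ∈ residual X := by
  refine residual_of_dense_open (isOpen_setOf_exists_smul_mem T x hO)
    (dense_iff_inter_open.2 fun V hV hVne => ?_)
  obtain ⟨y, hy, ht⟩ := exists_smul_mem_of_isOpen hmin hinv hwm x hV hVne hO hOne
  exact ⟨y, hy, ht⟩

/-- In the metrizable case, for a residual set of `y` the pair `(x, y)` is proximal along a
sequence. -/
theorem setOf_exists_tendsto_diagonal_mem_residual (hmin : MulAction.IsMinimal T X)
    (hinv : AdmitsInvariantMeasure T X) (hwm : WeakMixing T X)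
    [TopologicalSpace.MetrizableSpace X] (x : X) :
    {y | ∃ (t : ℕ → T) (z : X), Tendsto (fun n => (t n • x, t n • y)) atTop (𝓝 (z, z))} ∈
      residual X := by
  let _ : MetricSpace X := TopologicalSpace.metrizableSpaceMetric X
  have h : ∀ n : ℕ,
      {y | ∃ t : T, (t • x, t • y) ∈ {p : X × X | dist p.1 p.2 < 1 / ((n : ℝ) + 1)}} ∈ residual X :=
    fun n => setOf_exists_smul_mem_mem_residual hmin hinv hwm x
      (isOpen_lt (by fun_prop) continuous_const) ⟨(x, x), by simp; positivity⟩
  filter_upwards [countable_iInter_mem.2 h] with y hy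
  simp only [mem_iInter, mem_ofPred_eq] at hy
  choose t ht using hy
  obtain ⟨z, φ, hφ, hz⟩ := CompactSpace.tendsto_subseq fun n => t n • x
  refine ⟨t ∘ φ, z, hz.prodMk_nhds (hz.congr_dist ?_)⟩
  refine squeeze_zero (fun _ => dist_nonneg) (fun n => (ht (φ n)).le) ?_
  exact tendsto_one_div_add_atTop_nhds_zero_nat.comp hφ.tendsto_atTop

end Density

/-! ### Smallness of stable sets -/

section Stable

variable {T X : Type*} [Monoid T] [TopologicalSpace T] [UniformSpace X] [CompactSpace X]
  [T2Space X] [MeasurableSpace X] [BorelSpace X] [MulAction T X] [ContinuousSMul T X]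

/-- The set of `y` that stay `ε`-close to `x` outside a given compact set of times is nowhere dense,
provided that `ε ○ ε` is not dense. -/
theorem isNowhereDense_setOf_forall_notMem (hmin : MulAction.IsMinimal T X)
    (hinv : AdmitsInvariantMeasure T X) (hwm : WeakMixing T X) {ε η : Set (X × X)}
    (hεU : ε ∈ 𝓤 X) (hεc : IsClosed ε) (hεs : ∀ x y : X, (x, y) ∈ ε → (y, x) ∈ ε)
    (hη : IsClosed η) (hηne : η ≠ univ)
    (hεη : ∀ x y z : X, (x, y) ∈ ε → (y, z) ∈ ε → (x, z) ∈ η) {K : Set T} (hK : IsCompact K)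
    (x : X) : IsNowhereDense {y | ∀ t, t ∉ K → (t • x, t • y) ∈ ε} := by
  have hcl : IsClosed {y | ∀ t, t ∉ K → (t • x, t • y) ∈ ε} := by
    simp only [ofPred_forall]
    exact isClosed_iInter fun t => isClosed_iInter fun _ =>
      hεc.preimage (continuous_const.prodMk (continuous_const_smul t))
  rw [hcl.isNowhereDense_iff, ← not_nonempty_iff_eq_empty]
  rintro ⟨a, ha⟩
  -- Compactness of `K` controls the times in `K`; the other times go through `t • x`. So all pairs
  -- `(ta, ty)` lie in `η`, against density.
  have hnear : ∀ᶠ y in 𝓝 a, ∀ t ∈ K, (t • a, t • y) ∈ ε := by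
    refine hK.eventually_forall_of_forall_eventually (x₀ := a)
      (P := fun y t => (t • a, t • y) ∈ ε) fun t _ => ?_
    have hc : Continuous fun p : X × T => (p.2 • a, p.2 • p.1) := by fun_prop
    exact hc.continuousAt.eventually (p := (· ∈ ε)) (nhds_le_uniformity _ hεU)
  obtain ⟨V, hVsub, hV, haV⟩ := mem_nhds_iff.1 (hnear.and (isOpen_interior.mem_nhds ha))
  obtain ⟨y, hy, t, ht⟩ := exists_smul_mem_of_isOpen hmin hinv hwm a hV ⟨a, haV⟩ hη.isOpen_compl
    (nonempty_compl.2 hηne)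
  apply ht
  by_cases htK : t ∈ K
  · exact hεη _ _ _ (refl_mem_uniformity hεU) ((hVsub hy).1 t htK)
  · exact hεη _ _ _ (hεs _ _ (interior_subset ha t htK)) (interior_subset (hVsub hy).2 t htK)

/-- Some nonempty open set meets the `ε`-stable set of `x` in a meagre set. -/
theorem exists_isOpen_isMeagre_inter_stableSet [SigmaCompactSpace T] [Nontrivial X]
    (hmin : MulAction.IsMinimal T X)
    (hinv : AdmitsInvariantMeasure T X) (hwm : WeakMixing T X) {ε η : Set (X × X)}
    (hεU : ε ∈ 𝓤 X) (hεc : IsClosed ε) (hεs : ∀ x y : X, (x, y) ∈ ε → (y, x) ∈ ε)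
    (hη : IsClosed η) (hηne : η ≠ univ)
    (hεη : ∀ x y z : X, (x, y) ∈ ε → (y, z) ∈ ε → (x, z) ∈ η) (x : X) :
    ∃ V : Set X, IsOpen V ∧ V.Nonempty ∧ IsMeagre (V ∩ stableSet T ε x) := by
  -- With local compactness, countably many compact sets absorb every `K`, giving a countable union
  -- of nowhere dense sets.
  by_cases hT : WeaklyLocallyCompactSpace T
  · refine ⟨univ, isOpen_univ, univ_nonempty, ?_⟩
    let K := CompactExhaustion.choice T
    refine (isMeagre_iUnion fun n => (isNowhereDense_setOf_forall_notMem hmin hinv hwm hεU hεc hεs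
      hη hηne hεη (K.isCompact n) x).isMeagre).mono ?_
    rintro y ⟨-, C, -, hC, hCy⟩
    obtain ⟨n, hn⟩ := K.exists_superset_of_isCompact hC
    exact mem_iUnion.2 ⟨n, fun t ht => hCy t fun h => ht (hn h)⟩
  -- No compact set is a neighbourhood of `t₀`, so times off any compact set accumulate there, and
  -- closedness of `ε` forces closeness at `t₀` itself.
  · obtain ⟨t₀, ht₀⟩ : ∃ t₀ : T, ∀ C, IsCompact C → C ∉ 𝓝 t₀ := by
      by_contra! h
      exact hT ⟨h⟩
    have hsub : stableSet T ε x ⊆ {y | (t₀ • x, t₀ • y) ∈ ε} := by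
      rintro y ⟨C, -, hC, hCy⟩
      by_contra hy
      refine ht₀ C hC (mem_of_superset ?_ fun t (ht : (t • x, t • y) ∈ εᶜ) =>
        by_contra fun htC => ht (hCy t htC))
      have hc : Continuous fun t : T => (t • x, t • y) := by fun_prop
      exact hc.continuousAt.preimage_mem_nhds (hεc.isOpen_compl.mem_nhds hy)
    refine ⟨{y | (t₀ • x, t₀ • y) ∈ εᶜ}, hεc.isOpen_compl.preimage
      (continuous_const.prodMk (continuous_const_smul t₀)), ?_, ?_⟩
    · by_contra hne
      refine hηne (eq_univ_of_forall fun ⟨a, b⟩ => ?_)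
      -- Surjectivity of `t₀` would put every point `ε`-close to `t₀ • x`, so `η` would be
      -- everything.
      have hall : ∀ z, (t₀ • x, z) ∈ ε := fun z => by
        obtain ⟨y, rfl⟩ := surjective_smul_of_invariant hmin hinv t₀ z
        by_contra hy
        exact hne ⟨y, hy⟩
      exact hεη _ _ _ (hεs _ _ (hall a)) (hall b)
    · convert IsMeagre.empty
      exact eq_empty_of_forall_notMem fun y hy => hy.1 (hsub hy.2)

/-- A closed symmetric entourage whose square is contained in a proper closed set. -/
theorem exists_entourage (X : Type*) [UniformSpace X] [T2Space X] [Nontrivial X] :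
    ∃ ε ∈ 𝓤 X, IsClosed ε ∧ (∀ x y : X, (x, y) ∈ ε → (y, x) ∈ ε) ∧
      ∃ η : Set (X × X), IsClosed η ∧ η ≠ univ ∧
        ∀ x y z : X, (x, y) ∈ ε → (y, z) ∈ ε → (x, z) ∈ η := by
  obtain ⟨a, b, hab⟩ := exists_pair_ne X
  obtain ⟨W, hW, hWab⟩ : ∃ W ∈ 𝓤 X, (a, b) ∉ W := by
    by_contra! h
    exact hab (eq_of_uniformity fun {V} hV => h V hV)
  obtain ⟨η, ⟨hη, hηc⟩, hηW⟩ := uniformity_hasBasis_closed.mem_iff.1 hW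
  obtain ⟨d, hd, hdη⟩ := comp_mem_uniformity_sets hη
  obtain ⟨c, ⟨hc, hcc⟩, hcd⟩ := uniformity_hasBasis_closed.mem_iff.1 hd
  refine ⟨c ∩ Prod.swap ⁻¹' c, inter_mem hc (tendsto_swap_uniformity hc),
    hcc.inter (hcc.preimage continuous_swap), fun x y h => ⟨h.2, h.1⟩, η, hηc, ?_, ?_⟩
  · rintro rfl
    exact hWab (hηW (mem_univ _))
  · exact fun x y z h1 h2 => hdη ⟨y, hcd h1.1, hcd h2.1⟩

theorem not_isMeagre_diff_inter {Y : Type*} [TopologicalSpace Y] [BaireSpace Y] {V S R : Set Y}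
    (hV : IsOpen V) (hVne : V.Nonempty) (hS : IsMeagre (V ∩ S)) (hR : R ∈ residual Y) :
    ¬ IsMeagre {y | y ∉ S ∧ y ∈ R} := by
  intro h
  have hR' : IsMeagre Rᶜ := by rwa [IsMeagre, compl_compl]
  refine not_isMeagre_of_isOpen hV hVne (((hS.union h).union hR').mono fun y hy => ?_)
  by_cases h1 : y ∈ S
  · exact Or.inl (Or.inl ⟨hy, h1⟩)
  · by_cases h2 : y ∈ R
    · exact Or.inl (Or.inr ⟨h1, h2⟩)
    · exact Or.inr h2

end Stable

end Semiflow

theorem theorem4p19 {T X : Type*}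
    [Monoid T] [TopologicalSpace T] [ContinuousMul T] [SigmaCompactSpace T]
    [UniformSpace X] [CompactSpace X] [T2Space X] [Nontrivial X]
    [MeasurableSpace X] [BorelSpace X]
    [MulAction T X] [ContinuousSMul T X]
    (hmin : MulAction.IsMinimal T X)
    (hinv : Semiflow.AdmitsInvariantMeasure T X)
    (hwm : Semiflow.WeakMixing T X) :
    ∃ ε ∈ 𝓤 X, (∀ x y : X, (x, y) ∈ ε → (y, x) ∈ ε) ∧
      (∀ δ ∈ 𝓤 X, δ ⊆ ε → Semiflow.LiYorkeSensitive T X ε δ) ∧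
      (TopologicalSpace.MetrizableSpace X → Semiflow.LiYorkeSensitiveZero T X ε) := by
  obtain ⟨ε, hεU, hεc, hεs, η, hη, hηne, hεη⟩ := Semiflow.exists_entourage X
  have hV := Semiflow.exists_isOpen_isMeagre_inter_stableSet hmin hinv hwm hεU hεc hεs hη hηne hεη
  refine ⟨ε, hεU, hεs, fun δ hδ _ x => ?_, fun _ x => ?_⟩
  · obtain ⟨V, hVo, hVne, hVm⟩ := hV x
    refine Semiflow.not_isMeagre_diff_inter hVo hVne hVm (mem_of_superset
      (Semiflow.setOf_exists_smul_mem_mem_residual hmin hinv hwm x isOpen_interior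
        ⟨(x, x), mem_interior_iff_mem_nhds.2 (nhds_le_uniformity _ hδ)⟩) ?_)
    exact fun y ⟨t, ht⟩ => ⟨t, interior_subset ht⟩
  · obtain ⟨V, hVo, hVne, hVm⟩ := hV x
    exact Semiflow.not_isMeagre_diff_inter hVo hVne hVm
      (Semiflow.setOf_exists_tendsto_diagonal_mem_residual hmin hinv hwm x)
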